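/- Let $\mathbb K$ be $\mathbb R$ or $\mathbb C$, let $X$ be a Banach space over $\mathbb K$, and let $J:X\to X^{**}$ be the canonical isometric inclusion. Write $S_E$ for the unit sphere of a normed space $E$, and for $u\in S_E$ write $D(E,u)=\{\phi\in E^*:\|\phi\|=\phi(u)=1\}$. Suppose that $X$ is $M$-embedded, i.e. $J(X)$ is an $M$-ideal of $X^{**}$ (there is a closed subspace $Z$ of $X^{***}$ with $X^{***}=J(X)^{\perp}\oplus_1 Z$), or that $X$ is $L$-embedded, i.e. $X^{**}=J(X)\oplus_1 Z$ for some closed subspace $Z$ of $X^{**}$. Here $E=M\oplus_1 Z$ means that $E=M\oplus Z$ and $\|m+z\|=\|m\|+\|z\|$ for all $m\in M$, $z\in Z$. Then $(X,X^{**})$ is a Bishop–Phelps–Bollobás pair: for every $\varepsilon>0$ there is $\delta>0$ such that whenever $x_0\in S_X$ and $\phi_0\in S_{X^{***}}$ satisfy $\operatorname{Re}\phi_0(Jx_0)>1-\delta$, there are $x\in S_X$ and $\phi\in D(X^{**},Jx)$ with $\|x_0-x\|<\varepsilon$ and $\|\phi_0-\phi\|<\varepsilon$. Consequently, for every bounded,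 uniformly continuous function $f:S_X\to X^{**}$ one has $\overline{\mathrm{co}}\,W(f)=V(f)$, where $\overline{\mathrm{co}}$ denotes the closed convex hull, $$W(f)=\{\phi(f(x)) : x\in S_X,\ \phi\in D(X^{**},Jx)\},\qquad V(f)=\{\Phi(f) : \Phi\in B(S_X,X^{**})^*,\ \|\Phi\|=\Phi(J|_{S_X})=1\},$$ and $B(S_X,X^{**})$ is the Banach space of all bounded functions $S_X\to X^{**}$ with the supremum norm. -/

import Mathlib

open scoped ENNReal

namespace NumRange

section Pairs

variable (𝕜 : Type*) [RCLike 𝕜]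

/-- The set `D(E, u)` of states of `E` relative to `u`: functionals `φ` with `‖φ‖ = φ u = 1`. -/
def states {E : Type*} [NormedAddCommGroup E] [NormedSpace 𝕜 E] (u : E) :
    Set (StrongDual 𝕜 E) :=
  {φ | ‖φ‖ = 1 ∧ φ u = 1}

/-- The Banach space `B(S_X, Y)` of all bounded functions from the unit sphere of `X` to `Y`,
with the supremum norm. -/
abbrev BoundedOnSphere (X Y : Type*) [NormedAddCommGroup X] [NormedAddCommGroup Y] : Type _ :=
  lp (fun _ : Metric.sphere (0 : X) 1 => Y) ∞

variable {𝕜}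
variable {X Y : Type*} [NormedAddCommGroup X] [NormedSpace 𝕜 X]
  [NormedAddCommGroup Y] [NormedSpace 𝕜 Y]

/-- `Π(X, Y)`: the pairs `(x, y*)` with `x ∈ S_X` and `y* ∈ D(Y, J x)`. -/
def statePairs (J : X →ₗᵢ[𝕜] Y) : Set (X × StrongDual 𝕜 Y) :=
  {p | ‖p.1‖ = 1 ∧ p.2 ∈ states 𝕜 (J p.1)}

/-- `(X, Y)` is a Bishop-Phelps-Bollobás pair, for the isometric inclusion `J` of `X` in `Y`. -/
def IsBPBPair (J : X →ₗᵢ[𝕜] Y) : Prop :=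
  ∀ ε : ℝ, 0 < ε → ∃ δ : ℝ, 0 < δ ∧ ∀ (x₀ : X) (φ₀ : StrongDual 𝕜 Y),
    ‖x₀‖ = 1 → ‖φ₀‖ = 1 → 1 - δ < RCLike.re (φ₀ (J x₀)) →
      ∃ (x : X) (φ : StrongDual 𝕜 Y), (x, φ) ∈ statePairs J ∧ ‖x₀ - x‖ < ε ∧ ‖φ₀ - φ‖ < ε

/-- The restriction of the inclusion `J` to the unit sphere of `X`, as a bounded function. -/
def sphereInclusion (J : X →ₗᵢ[𝕜] Y) : BoundedOnSphere X Y :=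
  ⟨fun x => J x, memℓp_infty ⟨1, by
    rintro _ ⟨x, rfl⟩
    simp⟩⟩

/-- The spatial numerical range `W(f)`. -/
def spatialRange (J : X →ₗᵢ[𝕜] Y) (f : BoundedOnSphere X Y) : Set 𝕜 :=
  {c | ∃ (x : Metric.sphere (0 : X) 1) (φ : StrongDual 𝕜 Y),
    ((x : X), φ) ∈ statePairs J ∧ φ (f x) = c}

/-- The intrinsic numerical range `V(f)`. -/
def intrinsicRange (J : X →ₗᵢ[𝕜] Y) (f : BoundedOnSphere X Y) : Set 𝕜 :=
  {c | ∃ Φ : StrongDual 𝕜 (BoundedOnSphere X Y), Φ ∈ states 𝕜 (sphereInclusion J) ∧ Φ f = c}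

end Pairs

section Ideals

variable {𝕜 : Type*} [RCLike 𝕜] {Y : Type*} [NormedAddCommGroup Y] [NormedSpace 𝕜 Y]

/-- `M` is an L-summand of `Y`: `Y = M ⊕₁ Z` for some closed subspace `Z`. -/
def IsLSummand (M : Submodule 𝕜 Y) : Prop :=
  ∃ Z : Submodule 𝕜 Y, IsClosed (Z : Set Y) ∧ IsCompl M Z ∧
    ∀ x ∈ M, ∀ z ∈ Z, ‖x + z‖ = ‖x‖ + ‖z‖

/-- `M` is an M-ideal of `Y`: it is a closed subspace whose annihilator in the dual of `Y`
(its polar, as `M` is a subspace) is an L-summand of the dual. -/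
def IsMIdeal (M : Submodule 𝕜 Y) : Prop :=
  IsClosed (M : Set Y) ∧ IsLSummand (StrongDual.polarSubmodule 𝕜 M)

variable (𝕜)

/-- `X` is M-embedded: its canonical image in the bidual is an M-ideal of the bidual. -/
def IsMEmbedded (X : Type*) [NormedAddCommGroup X] [NormedSpace 𝕜 X] : Prop :=
  IsMIdeal (𝕜 := 𝕜) (Y := StrongDual 𝕜 (StrongDual 𝕜 X))
    (NormedSpace.inclusionInDoubleDualLi 𝕜 (E := X)).toLinearMap.range

/-- `X` is L-embedded: its canonical image in the bidual is an L-summand of the bidual. -/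
def IsLEmbedded (X : Type*) [NormedAddCommGroup X] [NormedSpace 𝕜 X] : Prop :=
  IsLSummand (𝕜 := 𝕜) (Y := StrongDual 𝕜 (StrongDual 𝕜 X))
    (NormedSpace.inclusionInDoubleDualLi 𝕜 (E := X)).toLinearMap.range

end Ideals

end NumRange

/-! The Bishop-Phelps-Bollobás theorem on `X` moves `x₀` and the restriction of `φ₀` to nearby `x`
and `ψ` with `ψ x = 1`. What remains is to lift `ψ` to the bidual near `φ₀` without exceeding norm 1
(`isBPBPair_of_lift`). If `X` is L-embedded, the lift acts as `ψ` on `X` and as `φ₀` on `Z`. If `X`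
is M-embedded, it is the canonical image of `ψ` in `X***`: elements of `Z` are canonical images of
their restrictions, and a functional almost norming a point of `X` has a small component in the
annihilator.

For the numerical ranges, a state `Φ` satisfies `1 + t Re Φ(f) ≤ ‖J + t f‖`. A point almost
attaining this norm and a functional norming the value there almost form a state pair; the
Bishop-Phelps-Bollobás property corrects them, and Hahn-Banach separation concludes. -/

/-- A weak form of **Ekeland's variational principle** for continuous nonnegative functions. -/
theorem exists_ekeland_point {E : Type*} [PseudoMetricSpace E] [CompleteSpace E] {F : E → ℝ}
    (hF : Continuous F) (hF₀ : ∀ x, 0 ≤ F x) {α : ℝ} (hα : 0 < α) (x₀ : E) :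
    ∃ x, F x + α * dist x x₀ ≤ F x₀ ∧ ∀ y, F x ≤ F y + α * dist y x := by
  -- Each iterate almost minimises `F` on the set of admissible successors of the previous one.
  -- These sets are nested by the triangle inequality, and their radii tend to 0.
  have step : ∀ (n : ℕ) (x : E), ∃ y, F y + α * dist y x ≤ F x ∧
      ∀ z, F z + α * dist z x ≤ F x → F y ≤ F z + (1 / 2) ^ n := by
    intro n x
    set S : Set ℝ := F '' {y | F y + α * dist y x ≤ F x} with hS
    have hne : S.Nonempty := ⟨F x, x, by simp, rfl⟩
    have hbdd : BddBelow S := ⟨0, by rintro _ ⟨y, -, rfl⟩; exact hF₀ y⟩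
    obtain ⟨_, ⟨y, hy, rfl⟩, hlt⟩ :=
      exists_lt_of_csInf_lt hne (lt_add_of_pos_right (sInf S) (by positivity : (0 : ℝ) < (1 / 2) ^ n))
    refine ⟨y, hy, fun z hz => ?_⟩
    have := csInf_le hbdd ⟨z, hz, rfl⟩
    linarith
  choose g hg hmin using step
  let u : ℕ → E := fun n => Nat.rec x₀ (fun n x => g n x) n
  have hsucc : ∀ n, u (n + 1) = g n (u n) := fun _ => rfl
  have trans : ∀ {a b c : E}, F a + α * dist a b ≤ F b → F b + α * dist b c ≤ F c →
      F a + α * dist a c ≤ F c := by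
    intro a b c hab hbc
    nlinarith [dist_triangle a b c]
  have hle : ∀ n m, n ≤ m → F (u m) + α * dist (u m) (u n) ≤ F (u n) := by
    intro n m hnm
    induction m, hnm using Nat.le_induction with
    | base => simp
    | succ m _ ih => exact trans (hsucc m ▸ hg m (u m)) ih
  have hcauchy : CauchySeq u := by
    rw [← cauchySeq_shift 1]
    refine cauchySeq_of_le_tendsto_0' (fun n => (1 / 2 : ℝ) ^ n / α) (fun n m hnm => ?_) ?_
    · have h₁ := hle (n + 1) (m + 1) (by omega)
      have h₂ := hmin n (u n) (u (m + 1)) (hle n (m + 1) (by omega))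
      rw [← hsucc] at h₂
      rw [dist_comm, le_div_iff₀ hα]
      linarith
    · simpa using (tendsto_pow_atTop_nhds_zero_of_lt_one (by norm_num : (0 : ℝ) ≤ 1 / 2)
        (by norm_num)).div_const α
  obtain ⟨x, hx⟩ := cauchySeq_tendsto_of_complete hcauchy
  have hFx : Filter.Tendsto (fun n => F (u n)) Filter.atTop (nhds (F x)) := (hF.tendsto x).comp hx
  have hxle : ∀ n, F x + α * dist x (u n) ≤ F (u n) := fun n =>
    le_of_tendsto (hFx.add ((hx.dist tendsto_const_nhds).const_mul α))
      (Filter.eventually_atTop.2 ⟨n, fun m hm => hle n m hm⟩)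
  refine ⟨x, hxle 0, fun y => ?_⟩
  by_contra! hy
  have hlim : F x ≤ F y := by
    have hr : Filter.Tendsto (fun n : ℕ => F y + (1 / 2 : ℝ) ^ n) Filter.atTop (nhds (F y + 0)) :=
      tendsto_const_nhds.add (tendsto_pow_atTop_nhds_zero_of_lt_one (by norm_num) (by norm_num))
    rw [add_zero] at hr
    refine le_of_tendsto_of_tendsto' (hFx.comp (Filter.tendsto_add_atTop_nat 1)) hr fun n => ?_
    exact hmin n (u n) y (trans hy.le (hxle n))
  nlinarith [dist_nonneg (x := y) (y := x)]

/-- If `y ↦ ‖y‖ - f y + α * ‖y - x‖` is minimal at `x`, then `f` is a norming functional at `x`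
up to an error of norm at most `α`. -/
theorem exists_norming_of_isMin {E : Type*} [NormedAddCommGroup E] [NormedSpace ℝ E]
    (f : E →ₗ[ℝ] ℝ) (hf : ∀ z, f z ≤ ‖z‖) {α : ℝ} (hα : 0 ≤ α) {x : E} (hx₀ : x ≠ 0)
    (hx : ∀ y, ‖x‖ - f x ≤ ‖y‖ - f y + α * ‖y - x‖) :
    ∃ h : E →ₗ[ℝ] ℝ, (∀ z, h z ≤ ‖z‖) ∧ (∀ z, h z ≤ f z + α * ‖z‖) ∧ h x = ‖x‖ := by
  -- The infimum over `u` is the inf-convolution of `‖·‖` and `f + α‖·‖`, a sublinear functional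
  -- below both (`u = z` and `u = 0`). Minimality at `x` says that it is at least `‖x‖` at `x`.
  let G : E → E → ℝ := fun z u => ‖u‖ + α * ‖u - z‖ - f (u - z)
  have hbdd : ∀ z, BddBelow (Set.range (G z)) := by
    refine fun z => ⟨f z, ?_⟩
    rintro _ ⟨u, rfl⟩
    have := hf u
    have : 0 ≤ α * ‖u - z‖ := by positivity
    simp only [G, map_sub]
    linarith
  have hle : ∀ z u, ⨅ v, G z v ≤ G z u := fun z u => ciInf_le (hbdd z) u
  have hsmul : ∀ c : ℝ, 0 < c → ∀ z u, G (c • z) (c • u) = c * G z u := by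
    intro c hc z u
    simp only [G, ← smul_sub, norm_smul, map_smul, Real.norm_eq_abs, abs_of_pos hc, smul_eq_mul]
    ring
  have hM : ∀ c : ℝ, 0 < c → ∀ z, ⨅ u, G (c • z) u = c * ⨅ u, G z u := by
    intro c hc z
    rw [Real.mul_iInf_of_nonneg hc.le]
    refine (Equiv.iInf_congr (Equiv.smulRight hc.ne') fun u => ?_).symm
    exact hsmul c hc z u
  have hadd : ∀ z w, ⨅ u, G (z + w) u ≤ (⨅ u, G z u) + ⨅ u, G w u := by
    intro z w
    refine le_ciInf_add_ciInf fun u v => (hle (z + w) (u + v)).trans ?_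
    have h₁ := norm_add_le u v
    have h₂ := mul_le_mul_of_nonneg_left (norm_add_le (u - z) (v - w)) hα
    have h₃ : u + v - (z + w) = (u - z) + (v - w) := by abel
    simp only [G, h₃, map_add]
    linarith
  obtain ⟨h, hext, hdom⟩ := exists_extension_of_le_sublinear
    (LinearPMap.mkSpanSingleton (K := ℝ) x ‖x‖ hx₀) (fun z => ⨅ u, G z u) hM hadd (by
      rintro ⟨z, hz⟩
      obtain ⟨t, rfl⟩ := Submodule.mem_span_singleton.1 hz
      rw [LinearPMap.mkSpanSingleton'_apply]
      refine le_ciInf fun u => ?_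
      simp only [RingHom.id_apply, smul_eq_mul, G]
      rcases le_or_gt t 0 with ht | ht
      · have h₁ := hf (u - t • x)
        have h₂ := norm_sub_le u (t • x)
        rw [norm_smul, Real.norm_eq_abs, abs_of_nonpos ht] at h₂
        have : 0 ≤ α * ‖u - t • x‖ := by positivity
        nlinarith
      · have h₁ := mul_le_mul_of_nonneg_left (hx (t⁻¹ • u)) ht.le
        have h₂ : u = t • t⁻¹ • u := by rw [smul_smul, mul_inv_cancel₀ ht.ne', one_smul]
        have h₃ := hsmul t ht x (t⁻¹ • u)
        rw [← h₂] at h₃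
        simp only [G] at h₃
        rw [h₃]
        simp only [map_sub] at h₁ ⊢
        linarith)
  refine ⟨h, fun z => ?_, fun z => ?_, ?_⟩
  · simpa [G] using (hdom z).trans (hle z z)
  · have := (hdom z).trans (hle z 0)
    simp only [G, norm_zero, zero_sub, norm_neg, map_neg] at this
    linarith
  · have := hext ⟨x, Submodule.mem_span_singleton_self x⟩
    rw [this]
    exact LinearPMap.mkSpanSingleton_apply ℝ ℝ hx₀ ‖x‖

/-! ### The Bishop-Phelps-Bollobás theorem over `𝕜` -/

section RCLike

variable {𝕜 : Type*} [RCLike 𝕜] {E : Type*} [NormedAddCommGroup E] [NormedSpace 𝕜 E]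

theorem norm_apply_le_of_re_apply_le (φ : E →ₗ[𝕜] 𝕜) {C : ℝ}
    (h : ∀ z, RCLike.re (φ z) ≤ C * ‖z‖) (z : E) : ‖φ z‖ ≤ C * ‖z‖ := by
  rcases eq_or_ne (φ z) 0 with h₀ | h₀
  · have h₁ := h z
    rw [h₀] at h₁ ⊢
    simpa using h₁
  · have h₁ := h (starRingEnd 𝕜 (φ z) • z)
    rw [map_smul, smul_eq_mul, RCLike.conj_mul, norm_smul, RCLike.norm_conj] at h₁
    norm_cast at h₁
    have h₂ : 0 < ‖φ z‖ := norm_pos_iff.2 h₀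
    nlinarith

/-- The **Bishop-Phelps-Bollobás theorem**. -/
theorem exists_bishop_phelps_bollobas [CompleteSpace E] {ε : ℝ} (hε : 0 < ε) (hε₁ : ε ≤ 1)
    {x₀ : E} {f : StrongDual 𝕜 E} (hx₀ : ‖x₀‖ = 1) (hf : ‖f‖ ≤ 1)
    (hfx : 1 - ε ^ 2 / 8 < RCLike.re (f x₀)) :
    ∃ (x : E) (φ : StrongDual 𝕜 E), ‖x‖ = 1 ∧ ‖φ‖ ≤ 1 ∧ φ x = 1 ∧ ‖x₀ - x‖ < ε ∧ ‖f - φ‖ < ε := by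
  let _ : NormedSpace ℝ E := NormedSpace.restrictScalars ℝ 𝕜 E
  have : IsScalarTower ℝ 𝕜 E := RestrictScalars.isScalarTower ℝ 𝕜 E
  let fr : E →ₗ[ℝ] ℝ := RCLike.reLm.comp (f.toLinearMap.restrictScalars ℝ)
  have hfr : ∀ z, fr z = RCLike.re (f z) := fun _ => rfl
  have hfr_le : ∀ z, fr z ≤ ‖z‖ := fun z =>
    (RCLike.re_le_norm (f z)).trans (by simpa using f.le_of_opNorm_le hf z)
  -- The initial value is below `ε ^ 2 / 8`, so slope `ε / 2` moves the point by less than `ε / 4`;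
  -- normalising it costs at most as much again.
  obtain ⟨x, hx, hmin⟩ := exists_ekeland_point (F := fun z => ‖z‖ - fr z)
    (by simp only [hfr]; fun_prop) (fun z => sub_nonneg.2 (hfr_le z)) (half_pos hε) x₀
  simp only [dist_eq_norm] at hx hmin
  have hdist : ‖x - x₀‖ < ε / 4 := by
    have := hfr_le x
    rw [hx₀, hfr x₀] at hx
    nlinarith
  have hnorm : |‖x‖ - 1| < ε / 4 := by
    rw [← hx₀]
    exact (abs_norm_sub_norm_le x x₀).trans_lt hdist
  have hxpos : 0 < ‖x‖ := by linarith [(abs_lt.1 hnorm).1]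
  obtain ⟨h, h_le, h_le', hhx⟩ := exists_norming_of_isMin fr hfr_le (half_pos hε).le
    (norm_pos_iff.1 hxpos) hmin
  let ψ : E →ₗ[𝕜] 𝕜 := Module.Dual.extendRCLike h
  have hψ : ∀ z, RCLike.re (ψ z) = h z := Module.Dual.re_extendRCLike_apply h
  have hψ_le : ∀ z, ‖ψ z‖ ≤ 1 * ‖z‖ :=
    norm_apply_le_of_re_apply_le ψ fun z => by rw [hψ, one_mul]; exact h_le z
  let φ : StrongDual 𝕜 E := ψ.mkContinuous 1 hψ_le
  have hφx : φ x = (‖x‖ : 𝕜) := by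
    have h₁ : RCLike.re (ψ x) = ‖x‖ := (hψ x).trans hhx
    have h₂ : ‖ψ x‖ ≤ RCLike.re (ψ x) := by simpa [h₁] using hψ_le x
    exact (RCLike.norm_le_re_iff_eq_norm.1 h₂).trans
      (congrArg _ (le_antisymm (h₂.trans_eq h₁) (h₁.symm.trans_le (RCLike.re_le_norm (ψ x)))))
  refine ⟨(‖x‖⁻¹ : 𝕜) • x, φ, ?_, ψ.mkContinuous_norm_le zero_le_one hψ_le, ?_, ?_, ?_⟩
  · rw [norm_smul, norm_inv, RCLike.norm_ofReal, abs_norm, inv_mul_cancel₀ hxpos.ne']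
  · rw [map_smul, hφx, smul_eq_mul, inv_mul_cancel₀]
    exact_mod_cast hxpos.ne'
  · have h₁ : ‖x - (‖x‖⁻¹ : 𝕜) • x‖ = |‖x‖ - 1| := by
      have : x - (‖x‖⁻¹ : 𝕜) • x = ((‖x‖ - 1 : ℝ) : 𝕜) • (‖x‖⁻¹ : 𝕜) • x := by
        rw [smul_smul]
        nth_rw 1 [← one_smul 𝕜 x]
        rw [← sub_smul]
        congr 1
        have : (‖x‖ : 𝕜) ≠ 0 := by exact_mod_cast hxpos.ne'
        push_cast
        field_simp
      rw [this, norm_smul, norm_smul, norm_inv, RCLike.norm_ofReal, RCLike.norm_ofReal, abs_norm,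
        inv_mul_cancel₀ hxpos.ne', mul_one]
    calc ‖x₀ - (‖x‖⁻¹ : 𝕜) • x‖ ≤ ‖x₀ - x‖ + ‖x - (‖x‖⁻¹ : 𝕜) • x‖ := norm_sub_le_norm_sub_add_norm_sub _ _ _
      _ < ε := by rw [h₁, norm_sub_rev]; linarith
  · refine lt_of_le_of_lt ?_ (half_lt_self hε)
    rw [norm_sub_rev]
    refine ContinuousLinearMap.opNorm_le_bound _ (half_pos hε).le ?_
    refine norm_apply_le_of_re_apply_le (φ - f).toLinearMap fun z => ?_
    have h₁ : RCLike.re ((φ - f) z) = h z - fr z := by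
      rw [sub_apply, map_sub, hfr, ← hψ]
      rfl
    rw [ContinuousLinearMap.coe_coe, h₁]
    linarith [h_le' z]

end RCLike

/-! ### Lifting from `X` to `Y`: L-summands and M-ideals -/

namespace NumRange

variable {𝕜 : Type*} [RCLike 𝕜] {X Y : Type*} [NormedAddCommGroup X] [NormedSpace 𝕜 X]
  [NormedAddCommGroup Y] [NormedSpace 𝕜 Y]

theorem mem_states_of_norm_le {E : Type*} [NormedAddCommGroup E] [NormedSpace 𝕜 E] {u : E}
    (hu : ‖u‖ ≤ 1) {φ : StrongDual 𝕜 E} (hφ : ‖φ‖ ≤ 1) (hφu : φ u = 1) : φ ∈ states 𝕜 u := by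
  refine ⟨le_antisymm hφ ?_, hφu⟩
  calc (1 : ℝ) = ‖φ u‖ := by rw [hφu, norm_one]
    _ ≤ ‖φ‖ * ‖u‖ := φ.le_opNorm u
    _ ≤ ‖φ‖ := mul_le_of_le_one_right (norm_nonneg _) hu

/-- To obtain a Bishop-Phelps-Bollobás pair it suffices to lift small perturbations of
restrictions of functionals to `X`, for functionals almost norming a point of `X`. -/
theorem isBPBPair_of_lift [CompleteSpace X] (J : X →ₗᵢ[𝕜] Y)
    (hJ : ∀ (η : ℝ) (φ₀ : StrongDual 𝕜 Y) (x₀ : X) (ψ : StrongDual 𝕜 X), 0 < η → ‖φ₀‖ = 1 →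
      ‖x₀‖ = 1 → 1 - η < RCLike.re (φ₀ (J x₀)) → ‖ψ‖ ≤ 1 →
      ∃ φ : StrongDual 𝕜 Y, ‖φ‖ ≤ 1 ∧ (∀ x, φ (J x) = ψ x) ∧
        ‖φ₀ - φ‖ ≤ ‖φ₀.comp J.toContinuousLinearMap - ψ‖ + η) : IsBPBPair J := by
  intro ε hε
  set ε' : ℝ := min (ε / 2) 1 with hε'
  have hε'₀ : 0 < ε' := by positivity
  have hε'₁ : ε' ≤ 1 := min_le_right _ _
  have hε'₂ : ε' ≤ ε / 2 := min_le_left _ _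
  refine ⟨ε' ^ 2 / 8, by positivity, fun x₀ φ₀ hx₀ hφ₀ hre => ?_⟩
  have hcomp : ‖φ₀.comp J.toContinuousLinearMap‖ ≤ 1 :=
    ContinuousLinearMap.opNorm_le_bound _ zero_le_one fun x => by
      simpa [hφ₀] using φ₀.le_opNorm (J x)
  obtain ⟨x, ψ, hx, hψ, hψx, hxx, hψψ⟩ := exists_bishop_phelps_bollobas hε'₀ hε'₁ hx₀ hcomp hre
  obtain ⟨φ, hφ, hφJ, hφφ⟩ := hJ (ε' ^ 2 / 8) φ₀ x₀ ψ (by positivity) hφ₀ hx₀ hre hψ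
  refine ⟨x, φ, ⟨hx, mem_states_of_norm_le (by simp [hx]) hφ (by rw [hφJ, hψx])⟩, by linarith, ?_⟩
  nlinarith

/-- A complemented isometric copy with an additive norm has a retraction splitting the norm. -/
theorem exists_retraction_of_isLSummand (J : X →ₗᵢ[𝕜] Y)
    (h : IsLSummand (𝕜 := 𝕜) J.toLinearMap.range) :
    ∃ T : Y →L[𝕜] X, (∀ x, T (J x) = x) ∧ ∀ y, ‖T y‖ + ‖y - J (T y)‖ = ‖y‖ := by
  obtain ⟨Z, -, hcompl, hnorm⟩ := h
  let T : Y →ₗ[𝕜] X := LinearMap.linearProjOfIsCompl Z J.toLinearMap J.injective hcompl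
  have hTJ : ∀ x, T (J x) = x :=
    fun x => LinearMap.linearProjOfIsCompl_apply_left Z J.toLinearMap J.injective hcompl x
  have hT : ∀ y, ‖T y‖ + ‖y - J (T y)‖ = ‖y‖ := by
    intro y
    have hz : y - J (T y) ∈ Z := by
      rw [← LinearMap.ker_linearProjOfIsCompl Z J.toLinearMap J.injective hcompl, LinearMap.mem_ker,
        map_sub]
      exact sub_eq_zero.2 (hTJ (T y)).symm
    rw [← J.norm_map (T y), ← hnorm (J (T y)) ⟨T y, rfl⟩ _ hz, add_sub_cancel]
  exact ⟨T.mkContinuous 1 fun y => by linarith [hT y, norm_nonneg (y - J (T y))], hTJ, hT⟩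

theorem isBPBPair_of_isLSummand_range [CompleteSpace X] (J : X →ₗᵢ[𝕜] Y)
    (h : IsLSummand (𝕜 := 𝕜) J.toLinearMap.range) : IsBPBPair J := by
  obtain ⟨T, hTJ, hT⟩ := exists_retraction_of_isLSummand J h
  have hT₁ : ∀ y, ‖T y‖ ≤ ‖y‖ := fun y => by linarith [hT y, norm_nonneg (y - J (T y))]
  refine isBPBPair_of_lift J fun η φ₀ x₀ ψ hη hφ₀ _ _ hψ => ?_
  set d : StrongDual 𝕜 X := φ₀.comp J.toContinuousLinearMap - ψ with hd
  have hdx : ∀ x, d x = φ₀ (J x) - ψ x := fun _ => rfl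
  -- This functional is `ψ` on the range of `J` and `φ₀` on the complement, so additivity of the
  -- norm keeps it in the unit ball.
  refine ⟨φ₀ - d.comp T, ?_, fun x => ?_, ?_⟩
  · refine ContinuousLinearMap.opNorm_le_bound _ zero_le_one fun y => ?_
    have h₁ : (φ₀ - d.comp T) y = ψ (T y) + φ₀ (y - J (T y)) := by
      rw [sub_apply, ContinuousLinearMap.comp_apply, hdx, map_sub]
      ring
    rw [h₁, one_mul, ← hT y]
    refine (norm_add_le _ _).trans (add_le_add ?_ ?_)
    · simpa using ψ.le_of_opNorm_le hψ (T y)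
    · simpa using φ₀.le_of_opNorm_le hφ₀.le (y - J (T y))
  · rw [sub_apply, ContinuousLinearMap.comp_apply, hTJ, hdx, sub_sub_cancel]
  · rw [sub_sub_cancel]
    have : ‖d.comp T‖ ≤ ‖d‖ := ContinuousLinearMap.opNorm_le_bound _ (norm_nonneg _) fun y =>
      (d.le_opNorm (T y)).trans (mul_le_mul_of_nonneg_left (hT₁ y) (norm_nonneg _))
    linarith

/-- An M-ideal `J X` of `Y` yields a Bishop-Phelps-Bollobás pair as soon as functionals on `X`
extend to `Y` linearly and isometrically. -/
theorem isBPBPair_of_isMIdeal_range [CompleteSpace X] (J : X →ₗᵢ[𝕜] Y)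
    (K : StrongDual 𝕜 X →ₗᵢ[𝕜] StrongDual 𝕜 Y) (hKJ : ∀ ψ x, K ψ (J x) = ψ x)
    (h : IsMIdeal (𝕜 := 𝕜) J.toLinearMap.range) : IsBPBPair J := by
  obtain ⟨-, Z, -, hcompl, hnorm⟩ := h
  have hmem : ∀ φ : StrongDual 𝕜 Y, (∀ x, φ (J x) = 0) →
      φ ∈ StrongDual.polarSubmodule 𝕜 J.toLinearMap.range := by
    intro φ hφ
    rw [StrongDual.mem_polarSubmodule]
    rintro _ ⟨x, rfl⟩
    exact hφ x
  -- The difference of the two sides annihilates `J X`, so its norm plus `‖z‖` is the norm of the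
  -- restriction of `z`, which is at most `‖z‖`.
  have hZ : ∀ z ∈ Z, K (z.comp J.toContinuousLinearMap) = z := by
    intro z hz
    have h₁ := hnorm (K (z.comp J.toContinuousLinearMap) - z)
      (hmem _ fun x => by rw [sub_apply, hKJ]; exact sub_self _) z hz
    have h₂ : ‖z.comp J.toContinuousLinearMap‖ ≤ ‖z‖ :=
      ContinuousLinearMap.opNorm_le_bound _ (norm_nonneg _) fun x => by
        simpa using z.le_opNorm (J x)
    rw [sub_add_cancel, K.norm_map] at h₁
    rw [← sub_eq_zero, ← norm_le_zero_iff]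
    linarith
  refine isBPBPair_of_lift J fun η φ₀ x₀ ψ hη hφ₀ hx₀ hre hψ =>
    ⟨K ψ, by rwa [K.norm_map], hKJ ψ, ?_⟩
  obtain ⟨m, hm, z, hz, rfl⟩ : ∃ m ∈ StrongDual.polarSubmodule 𝕜 J.toLinearMap.range,
      ∃ z ∈ Z, m + z = φ₀ := Submodule.mem_sup.1 (hcompl.sup_eq_top ▸ Submodule.mem_top)
  have hmJ : ∀ x, m (J x) = 0 := fun x => (StrongDual.mem_polarSubmodule 𝕜 _ m).1 hm _ ⟨x, rfl⟩
  have hcomp : (m + z).comp J.toContinuousLinearMap = z.comp J.toContinuousLinearMap := by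
    ext x
    exact (add_apply m z (J x)).trans (by rw [hmJ, zero_add]; rfl)
  -- Only `z` acts on `J x₀`; since `‖m‖ + ‖z‖ = 1`, this forces `‖m‖ < η`.
  have hzn : 1 - η < ‖z‖ := by
    refine hre.trans_le ?_
    rw [add_apply, hmJ, zero_add]
    refine (RCLike.re_le_norm _).trans ((z.le_opNorm _).trans ?_)
    rw [J.norm_map, hx₀, mul_one]
  rw [hnorm m hm z hz] at hφ₀
  have h₁ : m + z - K ψ = m + K (z.comp J.toContinuousLinearMap - ψ) := by
    rw [map_sub, hZ z hz]
    abel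
  rw [hcomp, h₁]
  refine (norm_add_le _ _).trans ?_
  rw [K.norm_map]
  linarith

theorem isBPBPair_of_isMEmbedded [CompleteSpace X] (h : IsMEmbedded 𝕜 X) :
    IsBPBPair (𝕜 := 𝕜) (X := X) (Y := StrongDual 𝕜 (StrongDual 𝕜 X))
      (NormedSpace.inclusionInDoubleDualLi 𝕜) :=
  isBPBPair_of_isMIdeal_range _ (NormedSpace.inclusionInDoubleDualLi 𝕜 (E := StrongDual 𝕜 X))
    (fun _ _ => rfl) h

/-! ### Numerical ranges -/

theorem norm_sphereInclusion_le (J : X →ₗᵢ[𝕜] Y) : ‖sphereInclusion J‖ ≤ 1 :=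
  lp.norm_le_of_forall_le zero_le_one fun x => by simp [sphereInclusion]

theorem spatialRange_subset_intrinsicRange (J : X →ₗᵢ[𝕜] Y) (f : BoundedOnSphere X Y) :
    spatialRange J f ⊆ intrinsicRange J f := by
  rintro _ ⟨x, φ, ⟨hx, hφ, hφx⟩, rfl⟩
  refine ⟨φ.comp (lp.evalCLM 𝕜 (fun _ : Metric.sphere (0 : X) 1 => Y) ∞ x), ?_, rfl⟩
  refine mem_states_of_norm_le (norm_sphereInclusion_le J) ?_ hφx
  refine ContinuousLinearMap.opNorm_le_bound _ zero_le_one fun g => ?_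
  have h₁ : ‖φ (g x)‖ ≤ 1 * ‖g x‖ := φ.le_of_opNorm_le hφ.le (g x)
  exact h₁.trans (mul_le_mul_of_nonneg_left
    (lp.norm_apply_le_norm ENNReal.top_ne_zero g x) zero_le_one)

theorem mem_states_sphereInclusion_iff (J : X →ₗᵢ[𝕜] Y) (Φ : StrongDual 𝕜 (BoundedOnSphere X Y)) :
    Φ ∈ states 𝕜 (sphereInclusion J) ↔ ‖Φ‖ ≤ 1 ∧ Φ (sphereInclusion J) = 1 :=
  ⟨fun h => ⟨h.1.le, h.2⟩, fun h => mem_states_of_norm_le (norm_sphereInclusion_le J) h.1 h.2⟩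

theorem convex_intrinsicRange (J : X →ₗᵢ[𝕜] Y) (f : BoundedOnSphere X Y) :
    Convex ℝ (intrinsicRange J f) := by
  rintro _ ⟨Φ, hΦ, rfl⟩ _ ⟨Ψ, hΨ, rfl⟩ a b ha hb hab
  rw [mem_states_sphereInclusion_iff] at hΦ hΨ
  refine ⟨(a : 𝕜) • Φ + (b : 𝕜) • Ψ, (mem_states_sphereInclusion_iff J _).2 ⟨?_, ?_⟩, ?_⟩
  · refine (norm_add_le _ _).trans ?_
    rw [norm_smul, norm_smul, RCLike.norm_of_nonneg ha, RCLike.norm_of_nonneg hb]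
    nlinarith
  · rw [add_apply, smul_apply, smul_apply, hΦ.2, hΨ.2, smul_eq_mul, smul_eq_mul, mul_one, mul_one]
    exact_mod_cast hab
  · simp [RCLike.real_smul_eq_coe_mul]

/-- By Banach-Alaoglu the states are weak-* compact, and evaluation at `f` is weak-* continuous. -/
theorem isClosed_intrinsicRange (J : X →ₗᵢ[𝕜] Y) (f : BoundedOnSphere X Y) :
    IsClosed (intrinsicRange J f) := by
  let e (g : BoundedOnSphere X Y) (Φ : WeakDual 𝕜 (BoundedOnSphere X Y)) : 𝕜 := Φ g
  have he : ∀ g, Continuous (e g) := fun g => WeakDual.eval_continuous g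
  have hcomp : IsCompact (WeakDual.toStrongDual ⁻¹'
      Metric.closedBall (0 : StrongDual 𝕜 (BoundedOnSphere X Y)) 1 ∩ e (sphereInclusion J) ⁻¹' {1}) :=
    (WeakDual.isCompact_closedBall 0 1).inter_right
      (isClosed_singleton.preimage (he (sphereInclusion J)))
  convert! (hcomp.image (he f)).isClosed using 1
  ext c
  constructor
  · rintro ⟨Φ, hΦ, rfl⟩
    rw [mem_states_sphereInclusion_iff] at hΦ
    exact ⟨WeakDual.toStrongDual.symm Φ, ⟨by simpa using hΦ.1, hΦ.2⟩, rfl⟩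
  · rintro ⟨Φ, ⟨hΦ, hΦ'⟩, rfl⟩
    exact ⟨WeakDual.toStrongDual Φ,
      (mem_states_sphereInclusion_iff J _).2 ⟨by simpa using hΦ, hΦ'⟩, rfl⟩

theorem exists_mem_spatialRange_re_gt {J : X →ₗᵢ[𝕜] Y} (hJ : IsBPBPair J)
    {f : BoundedOnSphere X Y} (hf : UniformContinuous (f : Metric.sphere (0 : X) 1 → Y))
    {Φ : StrongDual 𝕜 (BoundedOnSphere X Y)} (hΦ : Φ ∈ states 𝕜 (sphereInclusion J))
    {ε : ℝ} (hε : 0 < ε) : ∃ c ∈ spatialRange J f, RCLike.re (Φ f) - ε < RCLike.re c := by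
  set K := ‖f‖ with hK
  have hK₀ : 0 ≤ K := norm_nonneg f
  have hfK : ∀ x, ‖f x‖ ≤ K := lp.norm_apply_le_norm ENNReal.top_ne_zero f
  have hne : Nonempty (Metric.sphere (0 : X) 1) := by
    by_contra hempty
    rw [not_nonempty_iff] at hempty
    have h₁ := hΦ.2
    rw [lp.eq_zero' (sphereInclusion J), map_zero] at h₁
    exact zero_ne_one h₁
  obtain ⟨η, hη, hfη⟩ := Metric.uniformContinuous_iff.1 hf (ε / 3) (by positivity)
  obtain ⟨δ, hδ, hbpb⟩ := hJ (min η (ε / (3 * (K + 1)))) (by positivity)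
  set t : ℝ := min (ε / 3) (min 1 (δ / (2 * K + 2))) with ht
  have ht₀ : 0 < t := by positivity
  have htε : t ≤ ε / 3 := min_le_left _ _
  have ht₁ : t ≤ 1 := (min_le_right _ _).trans (min_le_left _ _)
  have htδ : t * (2 * K + 2) ≤ δ := by
    rw [← le_div_iff₀ (by positivity)]
    exact (min_le_right _ _).trans (min_le_right _ _)
  set g : BoundedOnSphere X Y := sphereInclusion J + (t : 𝕜) • f with hg
  have hgx : ∀ x : Metric.sphere (0 : X) 1, g x = J x + (t : 𝕜) • f x := fun _ => rfl
  have hΦg : 1 + t * RCLike.re (Φ f) ≤ ‖g‖ := by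
    have h₁ : RCLike.re (Φ g) = 1 + t * RCLike.re (Φ f) := by
      rw [hg, map_add, map_smul, hΦ.2, smul_eq_mul, map_add, RCLike.one_re, RCLike.re_ofReal_mul]
    rw [← h₁]
    simpa using (RCLike.re_le_norm _).trans (Φ.le_of_opNorm_le hΦ.1.le g)
  have hΦf : -K ≤ RCLike.re (Φ f) := by
    have := (abs_le.1 (RCLike.abs_re_le_norm (Φ f))).1
    have := Φ.le_of_opNorm_le hΦ.1.le f
    linarith
  -- A slack of order `t ^ 2` costs only `t` after division by `t`.
  obtain ⟨x, hx⟩ : ∃ x, ‖g‖ - t ^ 2 < ‖g x‖ := by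
    by_contra! h
    have := lp.norm_le_of_forall_le' _ h
    nlinarith
  have hx₁ : ‖(x : X)‖ = 1 := by simp
  have : Nontrivial Y := ⟨J x, 0, fun h => by
    have := J.norm_map x
    rw [h, norm_zero, hx₁] at this
    exact zero_ne_one this⟩
  obtain ⟨φ₀, hφ₀, hφ₀x⟩ := exists_dual_vector' 𝕜 (g x)
  have hre : RCLike.re (φ₀ (J x)) + t * RCLike.re (φ₀ (f x)) = ‖g x‖ := by
    have := congrArg RCLike.re hφ₀x
    rwa [hgx x, map_add, map_smul, smul_eq_mul, map_add, RCLike.re_ofReal_mul, ← hgx x,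
      RCLike.ofReal_re] at this
  have hφ₀f : RCLike.re (φ₀ (f x)) ≤ K := by
    have := (RCLike.re_le_norm _).trans (φ₀.le_of_opNorm_le hφ₀.le (f x))
    linarith [hfK x]
  have hφ₀J : RCLike.re (φ₀ (J x)) ≤ 1 := by
    have := (RCLike.re_le_norm _).trans (φ₀.le_of_opNorm_le hφ₀.le (J x))
    rwa [J.norm_map, hx₁, mul_one] at this
  have hlow : RCLike.re (Φ f) - t ≤ RCLike.re (φ₀ (f x)) := by
    have : t * (RCLike.re (Φ f) - t) ≤ t * RCLike.re (φ₀ (f x)) := by nlinarith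
    exact le_of_mul_le_mul_left this ht₀
  -- Here `Re φ₀ (J x) > 1 - t * (2 * K + t)`, which the choice of `t` keeps above `1 - δ`.
  obtain ⟨x', φ, hpair, hxx, hφφ⟩ := hbpb x φ₀ hx₁ hφ₀ (by nlinarith)
  have hx'S : x' ∈ Metric.sphere (0 : X) 1 := by simpa using hpair.1
  refine ⟨φ (f ⟨x', hx'S⟩), ⟨⟨x', hx'S⟩, φ, hpair, rfl⟩, ?_⟩
  have hdist : ‖f x - f ⟨x', hx'S⟩‖ < ε / 3 := by
    rw [← dist_eq_norm]
    refine hfη ?_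
    rw [Subtype.dist_eq, dist_eq_norm]
    exact hxx.trans_le (min_le_left _ _)
  have h₁ : RCLike.re (φ₀ (f x)) - RCLike.re (φ (f ⟨x', hx'S⟩)) =
      RCLike.re ((φ₀ - φ) (f x)) + RCLike.re (φ (f x - f ⟨x', hx'S⟩)) := by
    rw [sub_apply, map_sub, map_sub, map_sub]
    ring
  have h₂ : RCLike.re (φ (f x - f ⟨x', hx'S⟩)) < ε / 3 := by
    have := (RCLike.re_le_norm _).trans (φ.le_of_opNorm_le hpair.2.1.le (f x - f ⟨x', hx'S⟩))
    linarith
  have h₃ : RCLike.re ((φ₀ - φ) (f x)) ≤ ε / 3 := by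
    refine (RCLike.re_le_norm _).trans (((φ₀ - φ).le_opNorm (f x)).trans ?_)
    have h₄ : ‖φ₀ - φ‖ * (K + 1) ≤ ε / 3 := by
      rw [← le_div_iff₀ (by positivity), div_div]
      exact (hφφ.trans_le (min_le_right _ _)).le
    nlinarith [hfK x, norm_nonneg (φ₀ - φ)]
  linarith

/-- For a Bishop-Phelps-Bollobás pair, the closed convex hull of the spatial numerical range of a
bounded uniformly continuous function is its intrinsic numerical range. -/
theorem closedConvexHull_spatialRange {J : X →ₗᵢ[𝕜] Y} (hJ : IsBPBPair J)
    {f : BoundedOnSphere X Y} (hf : UniformContinuous (f : Metric.sphere (0 : X) 1 → Y)) :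
    closedConvexHull ℝ (spatialRange J f) = intrinsicRange J f := by
  refine (closedConvexHull_min (spatialRange_subset_intrinsicRange J f)
    (convex_intrinsicRange J f) (isClosed_intrinsicRange J f)).antisymm ?_
  rintro _ ⟨Φ, hΦ, rfl⟩
  by_contra hnot
  obtain ⟨l, s, hls, hsl⟩ := RCLike.geometric_hahn_banach_closed_point (𝕜 := 𝕜)
    convex_closedConvexHull isClosed_closedConvexHull hnot
  have hl : ∀ c, l c = l 1 * c := fun c => by
    rw [mul_comm, ← smul_eq_mul, ← map_smul, smul_eq_mul, mul_one]
  -- The separating functional is multiplication by `l 1`; absorbing this scalar into `f` reduces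
  -- separation to comparing real parts.
  obtain ⟨_, ⟨x, φ, hpair, rfl⟩, hc⟩ := exists_mem_spatialRange_re_gt hJ (f := l 1 • f)
    (hf.const_smul (l 1)) hΦ (sub_pos.2 hsl)
  have h₁ := hls _ (subset_closedConvexHull ⟨x, φ, hpair, rfl⟩)
  have h₂ : φ ((l 1 • f) x) = l (φ (f x)) := by
    rw [hl (φ (f x)), ← smul_eq_mul, ← map_smul]
    rfl
  rw [h₂, map_smul, smul_eq_mul, ← hl] at hc
  linarith

end NumRange

theorem mainTheorem11 (𝕜 : Type*) [RCLike 𝕜] (X : Type*) [NormedAddCommGroup X]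
    [NormedSpace 𝕜 X] [CompleteSpace X]
    (hX : NumRange.IsMEmbedded 𝕜 X ∨ NumRange.IsLEmbedded 𝕜 X) :
    NumRange.IsBPBPair (𝕜 := 𝕜) (X := X) (Y := StrongDual 𝕜 (StrongDual 𝕜 X))
        (NormedSpace.inclusionInDoubleDualLi 𝕜) ∧
      ∀ f : NumRange.BoundedOnSphere X (StrongDual 𝕜 (StrongDual 𝕜 X)),
        UniformContinuous (f : Metric.sphere (0 : X) 1 → StrongDual 𝕜 (StrongDual 𝕜 X)) →
          closedConvexHull ℝ
              (NumRange.spatialRange (𝕜 := 𝕜) (X := X)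
                (Y := StrongDual 𝕜 (StrongDual 𝕜 X))
                (NormedSpace.inclusionInDoubleDualLi 𝕜) f) =
            NumRange.intrinsicRange (𝕜 := 𝕜) (X := X)
              (Y := StrongDual 𝕜 (StrongDual 𝕜 X))
              (NormedSpace.inclusionInDoubleDualLi 𝕜) f := by
  have h : NumRange.IsBPBPair (𝕜 := 𝕜) (X := X) (Y := StrongDual 𝕜 (StrongDual 𝕜 X))
      (NormedSpace.inclusionInDoubleDualLi 𝕜) :=
    hX.elim NumRange.isBPBPair_of_isMEmbedded (NumRange.isBPBPair_of_isLSummand_range _)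
  exact ⟨h, fun _ hf => NumRange.closedConvexHull_spatialRange h hf⟩
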